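/- A \emph{polygon circle graph} is a graph isomorphic to the intersection graph of a finite family of (convex) polygons inscribed in the unit circle, that is, of convex hulls of finite sets of at least two points of the circle (a chord is allowed as a degenerate polygon with two vertices); two distinct members of the family are adjacent when they intersect. Every polygon circle graph $G$ with clique number $\omega$ satisfies $$\chi(G) \le 7\,\omega^4 .$$ -/

import Mathlib

/-- A polygon inscribed in the unit circle of the Euclidean plane, as a closed region: the convex
hull of finitely many points of the circle. At least two vertices are required, so chords are
allowed as degenerate polygons. -/
def IsInscribedPolygon (S : Set (EuclideanSpace ℝ (Fin 2))) : Prop :=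
  ∃ A : Finset (EuclideanSpace ℝ (Fin 2)),
    2 ≤ A.card ∧ (∀ p ∈ A, p ∈ Metric.sphere (0 : EuclideanSpace ℝ (Fin 2)) 1) ∧
      S = convexHull ℝ (A : Set (EuclideanSpace ℝ (Fin 2)))

/-- The intersection graph of a family of sets: distinct indices are adjacent when their sets
intersect. -/
def intersectionGraph {V X : Type*} (F : V → Set X) : SimpleGraph V where
  Adj u v := u ≠ v ∧ (F u ∩ F v).Nonempty
  symm := ⟨fun u v h => ⟨h.1.symm, by rw [Set.inter_comm]; exact h.2⟩⟩
  loopless := ⟨fun _ h => h.1 rfl⟩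

/-- A polygon circle graph: the intersection graph of a finite family of polygons inscribed in
the unit circle (the family is indexed by the vertices of the graph). -/
def IsPolygonCircleGraph {V : Type*} (G : SimpleGraph V) : Prop :=
  Finite V ∧ ∃ F : V → Set (EuclideanSpace ℝ (Fin 2)),
    (∀ v, IsInscribedPolygon (F v)) ∧ G = intersectionGraph F

/-!
Cut the circle open at angle `π`, and let each polygon span the interval from its least to its
greatest vertex angle. If two of these intervals overlap, the polygons intersect, so the overlap
graph of the intervals is a circle graph with clique number at most `ω`. In a colour class of this
graph the intervals are laminar, and an outer polygon meets an inner one if and only if it has a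
vertex facing the inner one. All outer neighbours of a polygon have such a vertex, hence have a
vertex facing each other, and form a clique: a greedy colouring from the outside inwards uses `ω`
colours (`colorable_of_angles`). It remains to colour circle graphs with `(12 * ω + 4) * ω` colours
(`exists_overlap_coloring`), since `(12 * ω + 4) * ω ^ 2 ≤ 7 * ω ^ 4` for `ω ≥ 2`.

For this, cuts of the line called pillars are placed one batch after the other, and each interval is
assigned to a pillar in it, from the first batch that hits it. The intervals at one pillar form a
comparability graph, so `ω` colours suffice for them. The pillars themselves need `12 * ω + 4`
colours for overlapping intervals at distinct pillars to differ. The invariant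
(`IsPillarAssignment`) is that a segment without pillars contains ends of intervals of at most
`8 * ω + 2` pillars. To refine such a segment, cut it greedily into pieces seeing at most `4 * ω`
of these pillars each. Consider the pairs formed by an old pillar on the left of the segment and a
piece that it sees: a set of pairs increasing in both coordinates gives pairwise overlapping
intervals, so each diagonal of the grid of pairs has at most `ω` elements, and their number is
linear (`card_cells_le`). The same holds on the right, and it follows that at most `4 * ω + 1` cuts
were made. With one more cut, placed to hit a prescribed interval, each piece sees at most
`4 * ω + (4 * ω + 2)` pillars, and there are enough colours for the new pillars to avoid each other
and all the pillars seen by the segment (`IsPillarAssignment.exists_refinement`).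
-/

/-! ### Two colouring lemmas for finite relations -/

/-- A transitive relation on a finite type whose chains have at most `k` elements has a height
function with values below `k`. -/
theorem exists_height_lt_of_trans {V : Type*} [Fintype V] (r : V → V → Prop)
    (irrefl : ∀ u, ¬ r u u) (trans : ∀ u v w, r u v → r v w → r u w) (k : ℕ)
    (hk : ∀ s : Finset V, (∀ u ∈ s, ∀ v ∈ s, u ≠ v → r u v ∨ r v u) → s.card ≤ k) :
    ∃ c : V → ℕ, (∀ v, c v < k) ∧ ∀ u v, r u v → c u < c v := by
  classical
  let C : V → Finset (Finset V) := fun v => Finset.univ.filter fun s =>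
    (∀ u ∈ s, ∀ w ∈ s, u ≠ w → r u w ∨ r w u) ∧ ∀ u ∈ s, r u v
  have hC : ∀ v s, s ∈ C v ↔
      (∀ u ∈ s, ∀ w ∈ s, u ≠ w → r u w ∨ r w u) ∧ ∀ u ∈ s, r u v := by
    intro v s; simp [C]
  have hins : ∀ v s, s ∈ C v → v ∉ s ∧
      ∀ u ∈ insert v s, ∀ w ∈ insert v s, u ≠ w → r u w ∨ r w u := by
    intro v s hs
    rw [hC] at hs
    refine ⟨fun h => irrefl _ (hs.2 _ h), fun u hu w hw huw => ?_⟩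
    rw [Finset.mem_insert] at hu hw
    rcases hu with rfl | hu <;> rcases hw with rfl | hw
    · exact absurd rfl huw
    · exact Or.inr (hs.2 _ hw)
    · exact Or.inl (hs.2 _ hu)
    · exact hs.1 u hu w hw huw
  refine ⟨fun v => (C v).sup Finset.card, fun v => ?_, fun u v huv => ?_⟩
  · have hpos : 0 < k := by
      have := hk {v} (by simp)
      rw [Finset.card_singleton] at this
      omega
    rw [Finset.sup_lt_iff (by simpa using hpos)]
    intro s hs
    obtain ⟨h1, h2⟩ := hins v s hs
    have := hk _ h2
    rw [Finset.card_insert_of_notMem h1] at this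
    omega
  · have hne : (C u).Nonempty := ⟨∅, by simp [hC]⟩
    obtain ⟨s, hs, hsup⟩ := Finset.exists_mem_eq_sup (C u) hne Finset.card
    obtain ⟨h1, h2⟩ := hins u s hs
    have hmem : insert u s ∈ C v := by
      rw [hC]
      refine ⟨h2, fun w hw => ?_⟩
      rcases Finset.mem_insert.1 hw with rfl | hw
      · exact huv
      · exact trans _ _ _ (((hC _ _).1 hs).2 w hw) huv
    have := Finset.le_sup (f := Finset.card) hmem
    rw [Finset.card_insert_of_notMem h1] at this
    simp only [hsup]
    omega

/-- Greedy colouring along `ord`: fewer than `k` smaller neighbours at each vertex give a proper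
colouring with `k` colours. -/
theorem exists_greedy_coloring {V α : Type*} [Fintype V] [LinearOrder α] (r : V → V → Prop)
    (symm : ∀ u v, r u v → r v u) (ord : V → α) (hord : ∀ u v, r u v → ord u ≠ ord v) (k : ℕ)
    (hk : ∀ v, ∀ s : Finset V, (∀ u ∈ s, r u v ∧ ord u < ord v) → s.card < k) :
    ∃ c : V → ℕ, (∀ v, c v < k) ∧ ∀ u v, r u v → c u ≠ c v := by
  classical
  suffices h : ∀ s : Finset V, ∃ c : V → ℕ, (∀ v ∈ s, c v < k) ∧
      ∀ u ∈ s, ∀ v ∈ s, r u v → c u ≠ c v by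
    obtain ⟨c, h1, h2⟩ := h Finset.univ
    exact ⟨c, fun v => h1 v (Finset.mem_univ _),
      fun u v => h2 u (Finset.mem_univ _) v (Finset.mem_univ _)⟩
  intro s
  induction s using Finset.induction_on_max_value ord with
  | empty => exact ⟨fun _ => 0, by simp, by simp⟩
  | insert a s ha hmax ih =>
    obtain ⟨c, h1, h2⟩ := ih
    have hcard : (s.filter fun u => r u a).card < k := by
      apply hk a
      intro u hu
      rw [Finset.mem_filter] at hu
      exact ⟨hu.2, lt_of_le_of_ne (hmax u hu.1) (hord _ _ hu.2)⟩
    obtain ⟨i, hi, hi'⟩ : ∃ i ∈ Finset.range k, i ∉ (s.filter fun u => r u a).image c := by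
      apply Finset.exists_mem_notMem_of_card_lt_card
      rw [Finset.card_range]
      exact Finset.card_image_le.trans_lt hcard
    have hi2 : ∀ u ∈ s, r u a → c u ≠ i := by
      intro u hu hr h
      exact hi' (Finset.mem_image.2 ⟨u, Finset.mem_filter.2 ⟨hu, hr⟩, h⟩)
    have hirr : ¬ r a a := fun h => hord _ _ h rfl
    have hne : ∀ u ∈ s, u ≠ a := fun u hu h => ha (h ▸ hu)
    refine ⟨Function.update c a i, fun v hv => ?_, fun u hu v hv huv => ?_⟩
    · rcases Finset.mem_insert.1 hv with rfl | hv
      · simpa using hi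
      · rw [Function.update_of_ne (hne v hv)]
        exact h1 v hv
    · rcases Finset.mem_insert.1 hu with rfl | hu' <;> rcases Finset.mem_insert.1 hv with rfl | hv'
      · exact absurd huv hirr
      · rw [Function.update_self, Function.update_of_ne (hne v hv')]
        exact (hi2 v hv' (symm _ _ huv)).symm
      · rw [Function.update_self, Function.update_of_ne (hne u hu')]
        exact hi2 u hu' huv
      · rw [Function.update_of_ne (hne u hu'), Function.update_of_ne (hne v hv')]
        exact h2 u hu' v hv' huv

/-! ### Cutting a segment greedily -/

/-- Let `f x y` measure the segment `[x, y)`, growing by at most one when `y` does. Cutting `[l, r)`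
as late as possible subject to `f ≤ T` gives cuts `s 1 < ⋯ < s m` such that every piece avoiding
the cuts has measure at most `T`, while each of the `m` segments `[s i, s (i + 1))`, `i < m`, has
measure at least `T`. -/
theorem exists_greedy_cuts (f : ℕ → ℕ → ℕ) (T : ℕ) (hT : 0 < T) (h0 : ∀ x, f x x = 0)
    (hstep : ∀ x y, f x (y + 1) ≤ f x y + 1)
    (hmono : ∀ x y x' y', x ≤ x' → y' ≤ y → f x' y' ≤ f x y) (r : ℕ) :
    ∀ n l, l + n = r → ∃ (m : ℕ) (s : ℕ → ℕ), s 0 = l ∧ StrictMono s ∧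
      (∀ i, 1 ≤ i → i ≤ m → s i < r) ∧ (∀ i < m, T ≤ f (s i) (s (i + 1))) ∧
      ∀ x y, l ≤ x → y ≤ r → (∀ i, 1 ≤ i → i ≤ m → ¬ (x < s i ∧ s i < y)) → f x y ≤ T := by
  intro n
  induction n using Nat.strong_induction_on with
  | _ n ih =>
    intro l hl
    by_cases hfl : f l r ≤ T
    · exact ⟨0, fun i => l + i, rfl, fun a b h => by simpa using h, fun i h1 h2 => by omega,
        fun i hi => by omega, fun x y hx hy _ => (hmono _ _ _ _ hx hy).trans hfl⟩
    · push Not at hfl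
      -- The first cut `Y` is the last place with `f l Y ≤ T`; the rest is cut recursively.
      let Y := Nat.findGreatest (fun y => f l y ≤ T) r
      have hlr : l ≤ r := by omega
      have hY : f l Y ≤ T :=
        Nat.findGreatest_spec (P := fun y => f l y ≤ T) (m := l) hlr (by simp [h0])
      have hYr : Y < r := by
        refine lt_of_le_of_ne (Nat.findGreatest_le r) fun h => ?_
        rw [h] at hY
        omega
      have hY1 : T < f l (Y + 1) := by
        by_contra hcon
        push Not at hcon
        have := Nat.le_findGreatest (P := fun y => f l y ≤ T) (m := Y + 1) (n := r) hYr hcon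
        change Y + 1 ≤ Y at this
        omega
      have hYT : T ≤ f l Y := by
        have := hstep l Y
        omega
      have hlY : l < Y := by
        by_contra hcon
        push Not at hcon
        have := hmono Y Y l Y hcon le_rfl
        rw [h0] at this
        omega
      obtain ⟨m, s, hs0, hsm, hsr, hsT, hsf⟩ := ih (r - Y) (by omega) Y (by omega)
      refine ⟨m + 1, fun i => if i = 0 then l else s (i - 1), by simp, ?_, ?_, ?_, ?_⟩
      · refine strictMono_nat_of_lt_succ fun i => ?_
        rcases i with _ | i
        · simpa [hs0] using hlY
        · simpa using hsm (Nat.lt_succ_self i)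
      · intro i h1 h2
        obtain ⟨j, rfl⟩ : ∃ j, i = j + 1 := ⟨i - 1, by omega⟩
        rcases j with _ | j
        · simpa [hs0] using hYr
        · simpa using hsr (j + 1) (by omega) (by omega)
      · intro i hi
        rcases i with _ | i
        · simpa [hs0] using hYT
        · simpa using hsT i (by omega)
      · intro x y hx hy hfree
        have hf1 := hfree 1 le_rfl (by omega)
        simp only [one_ne_zero, if_false, Nat.sub_self, hs0] at hf1
        by_cases hxY : x < Y
        · exact (hmono l Y x y hx (by omega)).trans hY
        · refine hsf x y (by omega) hy fun i h1 h2 => ?_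
          simpa using hfree (i + 1) (by omega) (by omega)

/-! ### Incidences between rows and segments -/

/-- A set of cells in a grid with rows `A` and columns `0, …, m - 1` whose strictly increasing
chains have at most `k` cells has at most `k * (|A| + m)` cells: each diagonal is a chain. -/
theorem card_cells_le (E : Finset (ℕ × ℕ)) (A : Finset ℕ) (m k : ℕ)
    (hE : ∀ e ∈ E, e.1 ∈ A ∧ e.2 < m)
    (hk : ∀ D ⊆ E, (∀ d ∈ D, ∀ e ∈ D, d ≠ e → (d.1 < e.1 ∧ d.2 < e.2) ∨ (e.1 < d.1 ∧ e.2 < d.2)) →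
      D.card ≤ k) : E.card ≤ k * (A.card + m) := by
  classical
  let rank : ℕ → ℕ := fun a => (A.filter (· < a)).card
  have hrank : ∀ a ∈ A, ∀ b, a < b → rank a < rank b := by
    intro a ha b hab
    apply Finset.card_lt_card
    rw [Finset.ssubset_iff_of_subset]
    · exact ⟨a, by simp [ha, hab], by simp⟩
    · intro x hx
      rw [Finset.mem_filter] at hx ⊢
      exact ⟨hx.1, hx.2.trans hab⟩
  have hrank' : ∀ a ∈ A, rank a < A.card := by
    intro a ha
    apply Finset.card_lt_card
    rw [Finset.ssubset_iff_of_subset (Finset.filter_subset _ _)]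
    exact ⟨a, ha, by simp⟩
  -- The diagonal through a cell, shifted so as to be a natural number.
  let diag : ℕ × ℕ → ℕ := fun e => rank e.1 + (m - e.2)
  have hmaps : ∀ e ∈ E, diag e ∈ Finset.range (A.card + m) := by
    intro e he
    have := hrank' _ (hE e he).1
    simp only [diag, Finset.mem_range]
    omega
  have := Finset.card_le_mul_card_image_of_maps_to hmaps k (by
    intro b _
    apply hk _ (Finset.filter_subset _ _)
    intro d hd e he hde
    rw [Finset.mem_filter] at hd he
    have hdE := hE d hd.1
    have heE := hE e he.1
    have hb : rank d.1 + (m - d.2) = rank e.1 + (m - e.2) := hd.2.trans he.2.symm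
    rcases lt_trichotomy d.1 e.1 with h | h | h
    · have := hrank _ hdE.1 _ h
      exact Or.inl ⟨h, by omega⟩
    · refine absurd (Prod.ext h ?_) hde
      rw [h] at hb
      omega
    · have := hrank _ heE.1 _ h
      exact Or.inr ⟨h, by omega⟩)
  rwa [Finset.card_range] at this

/-- If vertices increasing in both `ρ` and `e` are adjacent and cliques have at most `k` vertices,
then few pairs (value of `ρ`, segment) are realised by the vertices of `W`. -/
theorem sum_card_image_segment_le {V : Type*} (adj : V → V → Prop)
    (k : ℕ) (hk : ∀ s : Finset V, (∀ u ∈ s, ∀ v ∈ s, u ≠ v → adj u v ∨ adj v u) → s.card ≤ k)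
    (W : Finset V) (ρ e : V → ℕ) (hW : ∀ u ∈ W, ∀ v ∈ W, ρ u < ρ v → e u < e v → adj u v)
    (s : ℕ → ℕ) (hs : StrictMono s) (m : ℕ) :
    ∑ j ∈ Finset.range m,
      ((W.filter fun v => s j ≤ e v ∧ e v < s (j + 1)).image ρ).card ≤
        k * ((W.image ρ).card + m) := by
  classical
  let E : Finset (ℕ × ℕ) := (W.image ρ ×ˢ Finset.range m).filter fun c =>
    ∃ v ∈ W, ρ v = c.1 ∧ s c.2 ≤ e v ∧ e v < s (c.2 + 1)
  have hE : ∀ c ∈ E, (c.1 ∈ W.image ρ ∧ c.2 < m) ∧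
      ∃ v ∈ W, ρ v = c.1 ∧ s c.2 ≤ e v ∧ e v < s (c.2 + 1) := by
    intro c hc
    simpa only [E, Finset.mem_filter, Finset.mem_product, Finset.mem_range] using hc
  have hsum : ∑ j ∈ Finset.range m,
      ((W.filter fun v => s j ≤ e v ∧ e v < s (j + 1)).image ρ).card = E.card := by
    rw [Finset.card_eq_sum_card_fiberwise (f := Prod.snd) (t := Finset.range m)
      (fun c hc => by simpa using (hE c hc).1.2)]
    refine Finset.sum_congr rfl fun j hj => ?_
    refine Finset.card_bij' (fun a _ => (a, j)) (fun c _ => c.1) ?_ ?_ ?_ ?_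
    · intro a ha
      obtain ⟨v, hv, rfl⟩ := Finset.mem_image.1 ha
      rw [Finset.mem_filter] at hv
      simp only [E, Finset.mem_filter, Finset.mem_product]
      exact ⟨⟨⟨Finset.mem_image_of_mem _ hv.1, hj⟩, v, hv.1, rfl, hv.2⟩, trivial⟩
    · intro c hc
      rw [Finset.mem_filter] at hc
      obtain ⟨_, v, hv, h1, h2⟩ := hE c hc.1
      rw [hc.2] at h2
      exact Finset.mem_image.2 ⟨v, Finset.mem_filter.2 ⟨hv, h2⟩, h1⟩
    · intro a _
      rfl
    · intro c hc
      rw [Finset.mem_filter] at hc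
      exact Prod.ext rfl hc.2.symm
  rw [hsum]
  refine card_cells_le E (W.image ρ) m k (fun c hc => (hE c hc).1) fun D hD hchain => ?_
  -- A chain of cells yields a clique of the same size.
  rcases D.eq_empty_or_nonempty with rfl | ⟨c₀, hc₀⟩
  · simp
  have : Nonempty V := ⟨(hE c₀ (hD hc₀)).2.choose⟩
  choose! g hg using fun c (hc : c ∈ E) => (hE c hc).2
  have hlt : ∀ c ∈ D, ∀ d ∈ D, c.1 < d.1 ∧ c.2 < d.2 → adj (g c) (g d) := by
    intro c hc d hd h
    obtain ⟨h1, h2, h3, h4⟩ := hg c (hD hc)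
    obtain ⟨h1', h2', h3', h4'⟩ := hg d (hD hd)
    refine hW _ h1 _ h1' (by omega) ?_
    have := hs.monotone (show c.2 + 1 ≤ d.2 by omega)
    omega
  have hinj : Set.InjOn g D := by
    intro c hc d hd hcd
    by_contra hne
    have h1 := (hg c (hD hc)).2.1
    have h2 := (hg d (hD hd)).2.1
    rw [hcd] at h1
    rcases hchain c hc d hd hne with h | h <;> omega
  rw [← Finset.card_image_of_injOn hinj]
  refine hk _ fun u hu v hv huv => ?_
  obtain ⟨c, hc, rfl⟩ := Finset.mem_image.1 hu
  obtain ⟨d, hd, rfl⟩ := Finset.mem_image.1 hv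
  rcases hchain c hc d hd (fun h => huv (by rw [h])) with h | h
  · exact Or.inl (hlt c hc d hd h)
  · exact Or.inr (hlt d hd c hc h)

/-! ### Pillar assignments -/

/-- The intervals from `L u` to `R u` and from `L v` to `R v` overlap, the first one starting
first. -/
def Crosses {V : Type*} (L R : V → ℕ) (u v : V) : Prop :=
  L u < L v ∧ L v < R u ∧ R u < R v

/-- The interval of `v` contains a cut in `P`, where the cut `p` separates `p - 1` from `p`. -/
def IsHit {V : Type*} (L R : V → ℕ) (P : Finset ℕ) (v : V) : Prop :=
  ∃ p ∈ P, L v < p ∧ p ≤ R v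

/-- The segment `[x, y)` is not divided by a cut in `P`. -/
def IsUncut (P : Finset ℕ) (x y : ℕ) : Prop := ∀ p ∈ P, ¬ (x < p ∧ p < y)

open Classical in
/-- The pillars `ρ v` of the intervals `v` hit by `P` that have an end in `[x, y)`. -/
noncomputable def seenPillars {V : Type*} [Fintype V] (L R : V → ℕ) (P : Finset ℕ) (ρ : V → ℕ)
    (x y : ℕ) : Finset ℕ :=
  (Finset.univ.filter fun v =>
    IsHit L R P v ∧ ((x ≤ L v ∧ L v < y) ∨ (x ≤ R v ∧ R v < y))).image ρ

/-- The cuts in `P` serve as pillars: every interval `v` hit by `P` is assigned to a pillar `ρ v`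
in it, and the pillar `p` has colour `γ p < N`. Overlapping intervals at distinct pillars have
different colours, and segments without a cut see at most `K` pillars. The condition `order` holds
when each interval is assigned to the first of its pillars in some order of `P`. -/
structure IsPillarAssignment {V : Type*} [Fintype V] (L R : V → ℕ) (K N : ℕ)
    (P : Finset ℕ) (ρ : V → ℕ) (γ : ℕ → ℕ) : Prop where
  mem : ∀ v, IsHit L R P v → ρ v ∈ P ∧ L v < ρ v ∧ ρ v ≤ R v
  proper : ∀ u v, IsHit L R P u → IsHit L R P v → Crosses L R u v → γ (ρ u) = γ (ρ v) → ρ u = ρ v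
  order : ∀ u v, IsHit L R P u → IsHit L R P v → L u < ρ v → ρ v ≤ R u → L v < ρ u → ρ u ≤ R v →
    ρ u = ρ v
  few : ∀ x y, IsUncut P x y → (seenPillars L R P ρ x y).card ≤ K
  color_lt : ∀ p, γ p < N

section

variable {V : Type*} [Fintype V] {L R : V → ℕ} {P : Finset ℕ} {ρ : V → ℕ}

theorem mem_seenPillars {x y q : ℕ} : q ∈ seenPillars L R P ρ x y ↔ ∃ v, (IsHit L R P v ∧
    ((x ≤ L v ∧ L v < y) ∨ (x ≤ R v ∧ R v < y))) ∧ ρ v = q := by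
  simp [seenPillars]

theorem seenPillars_mono {x y x' y' : ℕ} (hx : x ≤ x') (hy : y' ≤ y) :
    seenPillars L R P ρ x' y' ⊆ seenPillars L R P ρ x y := by
  intro q hq
  rw [mem_seenPillars] at hq ⊢
  obtain ⟨v, ⟨h1, h2⟩, h3⟩ := hq
  exact ⟨v, ⟨h1, by omega⟩, h3⟩

/-- As no two intervals share an end, extending a segment by one brings in at most one pillar. -/
theorem card_seenPillars_succ_le (hinj : ∀ u v, u ≠ v → L u ≠ L v ∧ R u ≠ R v ∧ L u ≠ R v)
    (x y : ℕ) :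
    (seenPillars L R P ρ x (y + 1)).card ≤ (seenPillars L R P ρ x y).card + 1 := by
  classical
  have hone : ((Finset.univ.filter fun v => L v = y ∨ R v = y).image ρ).card ≤ 1 := by
    refine Finset.card_image_le.trans (Finset.card_le_one.2 fun u hu v hv => ?_)
    rw [Finset.mem_filter] at hu hv
    by_contra hne
    have h1 := hinj u v hne
    have h2 := hinj v u (Ne.symm hne)
    have := hu.2
    have := hv.2
    omega
  refine le_trans (Finset.card_le_card ?_) ((Finset.card_union_le _ _).trans
    (Nat.add_le_add_left hone _))
  intro q hq
  rw [mem_seenPillars] at hq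
  obtain ⟨v, ⟨h1, h2⟩, rfl⟩ := hq
  rw [Finset.mem_union, mem_seenPillars]
  by_cases h : L v = y ∨ R v = y
  · exact Or.inr (Finset.mem_image_of_mem _ (Finset.mem_filter.2 ⟨Finset.mem_univ _, h⟩))
  · exact Or.inl ⟨v, ⟨h1, by omega⟩, rfl⟩

/-- Intervals that enter an uncut segment from the left (or, symmetrically, from the right) overlap
as soon as their pillars and their ends in the segment are in the same order. Hence the number of
pairs formed by a pillar and one of `m` pieces that sees it is linear. -/
theorem IsPillarAssignment.sum_card_seenPillars_le {K N : ℕ} {γ : ℕ → ℕ}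
    (h : IsPillarAssignment L R K N P ρ γ) {k : ℕ}
    (hk : ∀ s : Finset V, (∀ u ∈ s, ∀ v ∈ s, u ≠ v → Crosses L R u v ∨ Crosses L R v u) →
      s.card ≤ k) {l r : ℕ} (hlr : IsUncut P l r) (s : ℕ → ℕ) (hs : StrictMono s) (m : ℕ)
    (hs0 : s 0 = l) (hsr : s m ≤ r) :
    ∑ j ∈ Finset.range m, (seenPillars L R P ρ (s j) (s (j + 1))).card ≤ k * (K + 2 * m) := by
  classical
  let WL : Finset V := Finset.univ.filter fun v => IsHit L R P v ∧ ρ v ≤ l ∧ l ≤ R v ∧ R v < r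
  let WR : Finset V := Finset.univ.filter fun v => IsHit L R P v ∧ r ≤ ρ v ∧ l ≤ L v ∧ L v < r
  have hWL : ∀ v, v ∈ WL ↔ IsHit L R P v ∧ ρ v ≤ l ∧ l ≤ R v ∧ R v < r := by simp [WL]
  have hWR : ∀ v, v ∈ WR ↔ IsHit L R P v ∧ r ≤ ρ v ∧ l ≤ L v ∧ L v < r := by simp [WR]
  have hL := sum_card_image_segment_le (Crosses L R) k hk WL ρ R (by
    intro u hu v hv h1 h2
    rw [hWL] at hu hv
    have hu' := h.mem u hu.1
    have hv' := h.mem v hv.1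
    have ho := h.order u v hu.1 hv.1
    refine ⟨?_, ?_, h2⟩ <;> omega) s hs m
  have hR := sum_card_image_segment_le (Crosses L R) k hk WR ρ L (by
    intro u hu v hv h1 h2
    rw [hWR] at hu hv
    have hu' := h.mem u hu.1
    have hv' := h.mem v hv.1
    have ho := h.order u v hu.1 hv.1
    refine ⟨h2, ?_, ?_⟩ <;> omega) s hs m
  have hK : (WL.image ρ).card + (WR.image ρ).card ≤ K := by
    rw [← Finset.card_union_of_disjoint]
    · refine le_trans (Finset.card_le_card ?_) (h.few l r hlr)
      intro q hq
      rw [Finset.mem_union, Finset.mem_image, Finset.mem_image] at hq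
      rw [mem_seenPillars]
      rcases hq with ⟨v, hv, rfl⟩ | ⟨v, hv, rfl⟩
      · rw [hWL] at hv
        exact ⟨v, ⟨hv.1, Or.inr hv.2.2⟩, rfl⟩
      · rw [hWR] at hv
        exact ⟨v, ⟨hv.1, Or.inl hv.2.2⟩, rfl⟩
    · rw [Finset.disjoint_left]
      intro q hq1 hq2
      rw [Finset.mem_image] at hq1 hq2
      obtain ⟨u, hu, rfl⟩ := hq1
      obtain ⟨v, hv, huv⟩ := hq2
      rw [hWL] at hu
      rw [hWR] at hv
      omega
  have hle : ∀ j ∈ Finset.range m, (seenPillars L R P ρ (s j) (s (j + 1))).card ≤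
      ((WL.filter fun v => s j ≤ R v ∧ R v < s (j + 1)).image ρ).card +
      ((WR.filter fun v => s j ≤ L v ∧ L v < s (j + 1)).image ρ).card := by
    intro j hj
    rw [Finset.mem_range] at hj
    refine le_trans (Finset.card_le_card ?_) (Finset.card_union_le _ _)
    intro q hq
    rw [mem_seenPillars] at hq
    obtain ⟨v, ⟨h1, h2⟩, rfl⟩ := hq
    have h3 := h.mem v h1
    have h4 := hlr _ h3.1
    have h5 := hs.monotone (Nat.zero_le j)
    have h6 := hs.monotone (show j + 1 ≤ m by omega)
    rw [Finset.mem_union]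
    by_cases h7 : ρ v ≤ l
    · refine Or.inl (Finset.mem_image_of_mem _ (Finset.mem_filter.2 ⟨(hWL v).2 ⟨h1, ?_⟩, ?_⟩)) <;>
        omega
    · refine Or.inr (Finset.mem_image_of_mem _ (Finset.mem_filter.2 ⟨(hWR v).2 ⟨h1, ?_⟩, ?_⟩)) <;>
        omega
  calc ∑ j ∈ Finset.range m, (seenPillars L R P ρ (s j) (s (j + 1))).card
      ≤ k * ((WL.image ρ).card + m) + k * ((WR.image ρ).card + m) := by
        refine (Finset.sum_le_sum hle).trans ?_
        rw [Finset.sum_add_distrib]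
        exact Nat.add_le_add hL hR
    _ = k * ((WL.image ρ).card + (WR.image ρ).card + 2 * m) := by ring
    _ ≤ k * (K + 2 * m) := Nat.mul_le_mul_left _ (by omega)

/-- In an uncut segment seeing at most `8 * k + 2` pillars, at most `4 * k + 1` cuts suffice for
every piece to see at most `4 * k` pillars. -/
theorem IsPillarAssignment.exists_cuts {k N : ℕ} {γ : ℕ → ℕ}
    (h : IsPillarAssignment L R (8 * k + 2) N P ρ γ) (hkpos : 0 < k)
    (hinj : ∀ u v, u ≠ v → L u ≠ L v ∧ R u ≠ R v ∧ L u ≠ R v)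
    (hk : ∀ s : Finset V, (∀ u ∈ s, ∀ v ∈ s, u ≠ v → Crosses L R u v ∨ Crosses L R v u) →
      s.card ≤ k) {l r : ℕ} (hle : l ≤ r) (hlr : IsUncut P l r) :
    ∃ Q : Finset ℕ, Q.card ≤ 4 * k + 1 ∧ (∀ q ∈ Q, l < q ∧ q < r) ∧
      ∀ x y, l ≤ x → y ≤ r → IsUncut Q x y → (seenPillars L R P ρ x y).card ≤ 4 * k := by
  classical
  obtain ⟨m, s, hs0, hs, hsr, hsT, hsf⟩ :=
    exists_greedy_cuts (fun x y => (seenPillars L R P ρ x y).card) (4 * k) (by omega)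
      (by
        intro x
        rw [Finset.card_eq_zero, Finset.eq_empty_iff_forall_notMem]
        intro q hq
        rw [mem_seenPillars] at hq
        obtain ⟨v, ⟨_, h2⟩, _⟩ := hq
        omega)
      (card_seenPillars_succ_le hinj)
      (fun x y x' y' hx hy => Finset.card_le_card (seenPillars_mono hx hy)) r (r - l) l (by omega)
  have hsm : s m ≤ r := by
    rcases m with _ | m
    · omega
    · exact (hsr (m + 1) (by omega) le_rfl).le
  have hsum := h.sum_card_seenPillars_le hk hlr s hs m hs0 hsm
  have hlow : m * (4 * k) ≤
      ∑ j ∈ Finset.range m, (seenPillars L R P ρ (s j) (s (j + 1))).card := by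
    have := Finset.card_nsmul_le_sum (Finset.range m)
      (fun j => (seenPillars L R P ρ (s j) (s (j + 1))).card) (4 * k)
      (fun j hj => hsT j (Finset.mem_range.1 hj))
    simpa using this
  -- From `4 * k * m ≤ k * (8 * k + 2 + 2 * m)`, since each of the `m` pieces sees `4 * k` pillars.
  have hm : m ≤ 4 * k + 1 := by
    have h1 : k * (2 * m) ≤ k * (8 * k + 2) := by nlinarith
    have := Nat.le_of_mul_le_mul_left h1 hkpos
    omega
  refine ⟨(Finset.Icc 1 m).image s, ?_, ?_, ?_⟩
  · refine Finset.card_image_le.trans ?_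
    rw [Nat.card_Icc]
    omega
  · intro q hq
    obtain ⟨i, hi, rfl⟩ := Finset.mem_image.1 hq
    rw [Finset.mem_Icc] at hi
    have := hs (show 0 < i by omega)
    exact ⟨by omega, hsr i hi.1 hi.2⟩
  · intro x y hx hy hfree
    exact hsf x y hx hy fun i h1 h2 =>
      hfree _ (Finset.mem_image_of_mem _ (Finset.mem_Icc.2 ⟨h1, h2⟩))

/-- A segment between two consecutive pillars can be refined, by fresh colours on the new pillars,
so that a given interval inside it gets hit. -/
theorem IsPillarAssignment.exists_refinement {k : ℕ} {γ : ℕ → ℕ}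
    (h : IsPillarAssignment L R (8 * k + 2) (12 * k + 4) P ρ γ) (hkpos : 0 < k)
    (hinj : ∀ u v, u ≠ v → L u ≠ L v ∧ R u ≠ R v ∧ L u ≠ R v) (hLR : ∀ v, L v < R v)
    (hk : ∀ s : Finset V, (∀ u ∈ s, ∀ v ∈ s, u ≠ v → Crosses L R u v ∨ Crosses L R v u) →
      s.card ≤ k) {l r : ℕ} (hl : l ∈ P) (hr : r ∈ P) (hlr : IsUncut P l r) {v₀ : V}
    (hlv₀ : l ≤ L v₀) (hrv₀ : R v₀ < r) :
    ∃ (P' : Finset ℕ) (ρ' : V → ℕ) (γ' : ℕ → ℕ), P ⊆ P' ∧ IsHit L R P' v₀ ∧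
      IsPillarAssignment L R (8 * k + 2) (12 * k + 4) P' ρ' γ' := by
  classical
  have hLR₀ := hLR v₀
  obtain ⟨Q₀, hQ₀, hQ₀lr, hQ₀f⟩ := h.exists_cuts hkpos hinj hk (by omega) hlr
  obtain ⟨Q, hQdef⟩ : ∃ Q, Q = insert (R v₀) Q₀ := ⟨_, rfl⟩
  have hQ : Q.card ≤ 4 * k + 2 := by
    rw [hQdef]
    exact (Finset.card_insert_le _ _).trans (by omega)
  have hQlr : ∀ q ∈ Q, l < q ∧ q < r := by
    intro q hq
    rw [hQdef, Finset.mem_insert] at hq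
    rcases hq with rfl | hq
    · omega
    · exact hQ₀lr q hq
  have hQP : ∀ q ∈ Q, q ∉ P := fun q hq hqP => hlr q hqP (hQlr q hq)
  have hQf : ∀ x y, l ≤ x → y ≤ r → IsUncut Q x y →
      (seenPillars L R P ρ x y).card ≤ 4 * k := fun x y hx hy hf =>
    hQ₀f x y hx hy fun q hq => hf q (by rw [hQdef]; exact Finset.mem_insert_of_mem hq)
  -- Fresh colours for the new pillars.
  obtain ⟨g, hginj, hgN, hgfresh⟩ : ∃ g : ℕ → ℕ, Set.InjOn g Q ∧ (∀ q ∈ Q, g q < 12 * k + 4) ∧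
      ∀ q ∈ Q, g q ∉ (seenPillars L R P ρ l r).image γ := by
    have hc : Q.card ≤
        (Finset.range (12 * k + 4) \ (seenPillars L R P ρ l r).image γ).card := by
      have h1 := Finset.le_card_sdiff ((seenPillars L R P ρ l r).image γ)
        (Finset.range (12 * k + 4))
      have h2 : ((seenPillars L R P ρ l r).image γ).card ≤ _ := Finset.card_image_le
      have h3 := h.few l r hlr
      rw [Finset.card_range] at h1
      omega
    obtain ⟨g, hg, hginj⟩ := Q.finite_toSet.exists_injOn_of_encard_le
      (t := (↑(Finset.range (12 * k + 4) \ (seenPillars L R P ρ l r).image γ) : Set ℕ))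
      (by rw [Set.encard_coe_eq_coe_finsetCard, Set.encard_coe_eq_coe_finsetCard]
          exact_mod_cast hc)
    have hg' : ∀ q ∈ Q, g q ∈
        Finset.range (12 * k + 4) \ (seenPillars L R P ρ l r).image γ := fun q hq => hg hq
    exact ⟨g, hginj, fun q hq => Finset.mem_range.1 (Finset.mem_sdiff.1 (hg' q hq)).1,
      fun q hq => (Finset.mem_sdiff.1 (hg' q hq)).2⟩
  -- The leftmost new pillar in an interval.
  have hfirst : ∀ v, IsHit L R Q v → ∃ q ∈ Q, (L v < q ∧ q ≤ R v) ∧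
      ∀ q' ∈ Q, L v < q' → q' ≤ R v → q ≤ q' := by
    rintro v ⟨p, hp, hpv⟩
    have hne : (Q.filter fun q => L v < q ∧ q ≤ R v).Nonempty :=
      ⟨p, Finset.mem_filter.2 ⟨hp, hpv⟩⟩
    have hmin := Finset.mem_filter.1 (Finset.min'_mem _ hne)
    exact ⟨_, hmin.1, hmin.2, fun q' h1 h2 h3 =>
      Finset.min'_le _ _ (Finset.mem_filter.2 ⟨h1, h2, h3⟩)⟩
  choose! f hfQ hfmem hfmin using hfirst
  obtain ⟨ρ', hρ'⟩ : ∃ ρ' : V → ℕ, ρ' = fun v => if IsHit L R P v then ρ v else f v := ⟨_, rfl⟩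
  have hold : ∀ v, IsHit L R P v → ρ' v = ρ v := fun v hv => by rw [hρ']; exact if_pos hv
  have hnew : ∀ v, ¬ IsHit L R P v → ρ' v = f v := fun v hv => by rw [hρ']; exact if_neg hv
  obtain ⟨γ', hγ'⟩ : ∃ γ' : ℕ → ℕ, γ' = fun p => if p ∈ Q then g p else γ p := ⟨_, rfl⟩
  have hγQ : ∀ q ∈ Q, γ' q = g q := fun q hq => by rw [hγ']; exact if_pos hq
  have hγP : ∀ p ∈ P, γ' p = γ p := fun p hp => by
    rw [hγ']; exact if_neg fun hq => hQP p hq hp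
  have hunion : ∀ v, IsHit L R (P ∪ Q) v → ¬ IsHit L R P v → IsHit L R Q v := by
    rintro v ⟨p, hp, hpv⟩ hv
    rcases Finset.mem_union.1 hp with hp | hp
    · exact absurd ⟨p, hp, hpv⟩ hv
    · exact ⟨p, hp, hpv⟩
  -- Newly hit intervals lie inside the segment.
  have hinside : ∀ v, IsHit L R Q v → ¬ IsHit L R P v → l ≤ L v ∧ R v < r := by
    rintro v ⟨p, hp, hpv⟩ hv
    have hp' := hQlr p hp
    constructor
    · by_contra hcon
      exact hv ⟨l, hl, by omega⟩
    · by_contra hcon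
      exact hv ⟨r, hr, by omega⟩
  -- An old interval overlapping a newly hit one has its pillar among those seen by the segment.
  have hclash : ∀ u v, IsHit L R P u → IsHit L R Q v → ¬ IsHit L R P v →
      Crosses L R u v ∨ Crosses L R v u → γ' (ρ' u) ≠ γ' (ρ' v) := by
    intro u v hu hv hv' hc
    rw [hold u hu, hnew v hv', hγP _ (h.mem u hu).1, hγQ _ (hfQ v hv)]
    intro heq
    refine hgfresh _ (hfQ v hv) (heq ▸ Finset.mem_image_of_mem _ (mem_seenPillars.2
      ⟨u, ⟨hu, ?_⟩, rfl⟩))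
    have := hinside v hv hv'
    unfold Crosses at hc
    omega
  refine ⟨P ∪ Q, ρ', γ', Finset.subset_union_left,
    ⟨R v₀, Finset.mem_union_right _ (by rw [hQdef]; exact Finset.mem_insert_self _ _), hLR₀, le_rfl⟩,
    ?_, ?_, ?_, ?_, ?_⟩
  · intro v hv
    by_cases hvP : IsHit L R P v
    · rw [hold v hvP]
      exact ⟨Finset.mem_union_left _ (h.mem v hvP).1, (h.mem v hvP).2⟩
    · rw [hnew v hvP]
      have hvQ := hunion v hv hvP
      exact ⟨Finset.mem_union_right _ (hfQ v hvQ), hfmem v hvQ⟩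
  · intro u v hu hv hc heq
    by_cases huP : IsHit L R P u <;> by_cases hvP : IsHit L R P v
    · rw [hold u huP, hold v hvP] at heq ⊢
      rw [hγP _ (h.mem u huP).1, hγP _ (h.mem v hvP).1] at heq
      exact h.proper u v huP hvP hc heq
    · exact absurd heq (hclash u v huP (hunion v hv hvP) hvP (Or.inl hc))
    · exact absurd heq.symm (hclash v u hvP (hunion u hu huP) huP (Or.inr hc))
    · have huQ := hfQ u (hunion u hu huP)
      have hvQ := hfQ v (hunion v hv hvP)
      rw [hnew u huP, hnew v hvP] at heq ⊢
      rw [hγQ _ huQ, hγQ _ hvQ] at heq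
      exact hginj huQ hvQ heq
  · intro u v hu hv h1 h2 h3 h4
    by_cases huP : IsHit L R P u <;> by_cases hvP : IsHit L R P v
    · rw [hold u huP, hold v hvP] at *
      exact h.order u v huP hvP h1 h2 h3 h4
    · rw [hold u huP] at h3 h4
      exact absurd ⟨ρ u, (h.mem u huP).1, h3, h4⟩ hvP
    · rw [hold v hvP] at h1 h2
      exact absurd ⟨ρ v, (h.mem v hvP).1, h1, h2⟩ huP
    · have huQ := hunion u hu huP
      have hvQ := hunion v hv hvP
      rw [hnew u huP] at *
      rw [hnew v hvP] at *
      exact le_antisymm (hfmin u huQ _ (hfQ v hvQ) h1 h2) (hfmin v hvQ _ (hfQ u huQ) h3 h4)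
  · intro x y hxy
    have hxyP : IsUncut P x y := fun p hp => hxy p (Finset.mem_union_left _ hp)
    have hxyQ : IsUncut Q x y := fun p hp => hxy p (Finset.mem_union_right _ hp)
    by_cases hex : ∃ v, IsHit L R Q v ∧ ¬ IsHit L R P v ∧
        ((x ≤ L v ∧ L v < y) ∨ (x ≤ R v ∧ R v < y))
    · obtain ⟨v, hvQ, hvP, hvxy⟩ := hex
      have hv := hinside v hvQ hvP
      have hlv := hLR v
      have hxl := hxyP l hl
      have hyr := hxyP r hr
      have hT := hQf x y (by omega) (by omega) hxyQ
      -- At most `4 * k` old pillars and `4 * k + 2` new ones are seen.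
      refine (Finset.card_le_card (t := seenPillars L R P ρ x y ∪ Q) ?_).trans
        ((Finset.card_union_le _ _).trans (by omega))
      intro q hq
      rw [mem_seenPillars] at hq
      obtain ⟨w, ⟨h1, h2⟩, rfl⟩ := hq
      rw [Finset.mem_union]
      by_cases hwP : IsHit L R P w
      · rw [hold w hwP]
        exact Or.inl (mem_seenPillars.2 ⟨w, ⟨hwP, h2⟩, rfl⟩)
      · rw [hnew w hwP]
        exact Or.inr (hfQ w (hunion w h1 hwP))
    · push Not at hex
      refine (Finset.card_le_card ?_).trans (h.few x y hxyP)
      intro q hq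
      rw [mem_seenPillars] at hq
      obtain ⟨w, ⟨h1, h2⟩, rfl⟩ := hq
      by_cases hwP : IsHit L R P w
      · rw [hold w hwP]
        exact mem_seenPillars.2 ⟨w, ⟨hwP, h2⟩, rfl⟩
      · have := hex w (hunion w h1 hwP) hwP
        omega
  · intro p
    by_cases hp : p ∈ Q
    · rw [hγQ p hp]
      exact hgN p hp
    · rw [hγ']
      simp only [if_neg hp]
      exact h.color_lt p

/-- A maximal refinement hits every interval. -/
theorem exists_pillarAssignment {k : ℕ} (hkpos : 0 < k)
    (hinj : ∀ u v, u ≠ v → L u ≠ L v ∧ R u ≠ R v ∧ L u ≠ R v) (hLR : ∀ v, L v < R v)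
    (hk : ∀ s : Finset V, (∀ u ∈ s, ∀ v ∈ s, u ≠ v → Crosses L R u v ∨ Crosses L R v u) →
      s.card ≤ k) :
    ∃ (P : Finset ℕ) (ρ : V → ℕ) (γ : ℕ → ℕ), (∀ v, IsHit L R P v) ∧
      IsPillarAssignment L R (8 * k + 2) (12 * k + 4) P ρ γ := by
  classical
  -- The pillars `0` and `M` are in no interval; they bound the outermost segments.
  obtain ⟨M, hM⟩ : ∃ M, ∀ v, R v < M :=
    ⟨Finset.univ.sup R + 1, fun v => Nat.lt_succ_of_le (Finset.le_sup (Finset.mem_univ v))⟩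
  have hhit0 : ∀ v, ¬ IsHit L R {0, M} v := by
    rintro v ⟨p, hp, hpv⟩
    have := hM v
    simp only [Finset.mem_insert, Finset.mem_singleton] at hp
    omega
  suffices H : ∀ (n : ℕ) (P : Finset ℕ) (ρ : V → ℕ) (γ : ℕ → ℕ), {0, M} ⊆ P →
      IsPillarAssignment L R (8 * k + 2) (12 * k + 4) P ρ γ →
      (Finset.univ.filter fun v => ¬ IsHit L R P v).card = n →
      ∃ (P : Finset ℕ) (ρ : V → ℕ) (γ : ℕ → ℕ), (∀ v, IsHit L R P v) ∧
        IsPillarAssignment L R (8 * k + 2) (12 * k + 4) P ρ γ by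
    refine H _ {0, M} (fun _ => 0) (fun _ => 0) subset_rfl ⟨?_, ?_, ?_, ?_, ?_⟩ rfl
    · exact fun v hv => absurd hv (hhit0 v)
    · exact fun u v hu => absurd hu (hhit0 u)
    · exact fun u v hu => absurd hu (hhit0 u)
    · intro x y _
      have : seenPillars L R {0, M} (fun _ => 0) x y = ∅ := by
        rw [Finset.eq_empty_iff_forall_notMem]
        intro q hq
        obtain ⟨v, ⟨hv, _⟩, _⟩ := mem_seenPillars.1 hq
        exact hhit0 v hv
      rw [this]
      simp
    · intro p
      omega
  intro n
  induction n using Nat.strong_induction_on with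
  | _ n ih =>
    intro P ρ γ hP h hn
    by_cases hall : ∀ v, IsHit L R P v
    · exact ⟨P, ρ, γ, hall, h⟩
    · push Not at hall
      obtain ⟨v₀, hv₀⟩ := hall
      have hMv := hM v₀
      have hLRv := hLR v₀
      have hne1 : (P.filter (· ≤ L v₀)).Nonempty :=
        ⟨0, Finset.mem_filter.2 ⟨hP (by simp), Nat.zero_le _⟩⟩
      have hne2 : (P.filter (L v₀ < ·)).Nonempty :=
        ⟨M, Finset.mem_filter.2 ⟨hP (by simp), by omega⟩⟩
      have hl := Finset.mem_filter.1 (Finset.max'_mem _ hne1)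
      have hr := Finset.mem_filter.1 (Finset.min'_mem _ hne2)
      have hlr : IsUncut P ((P.filter (· ≤ L v₀)).max' hne1) ((P.filter (L v₀ < ·)).min' hne2) := by
        rintro p hp ⟨h1, h2⟩
        by_cases hpv : p ≤ L v₀
        · exact absurd (Finset.le_max' _ p (Finset.mem_filter.2 ⟨hp, hpv⟩)) (not_le.2 h1)
        · exact absurd (Finset.min'_le _ p (Finset.mem_filter.2 ⟨hp, not_le.1 hpv⟩)) (not_le.2 h2)
      have hrv : R v₀ < (P.filter (L v₀ < ·)).min' hne2 := by
        by_contra hcon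
        exact hv₀ ⟨_, hr.1, hr.2, not_lt.1 hcon⟩
      obtain ⟨P', ρ', γ', hPP', hhit, h'⟩ :=
        h.exists_refinement hkpos hinj hLR hk hl.1 hr.1 hlr hl.2 hrv
      refine ih _ ?_ P' ρ' γ' (hP.trans hPP') h' rfl
      rw [← hn]
      apply Finset.card_lt_card
      rw [Finset.ssubset_iff_of_subset]
      · exact ⟨v₀, by simp [hv₀], by simp [hhit]⟩
      · intro v hv
        rw [Finset.mem_filter] at hv ⊢
        refine ⟨hv.1, fun ⟨p, hp, hpv⟩ => hv.2 ⟨p, hPP' hp, hpv⟩⟩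

/-- A circle graph with clique number at most `k`, given by intervals with distinct ends, has a
proper colouring with `(12 * k + 4) * k` colours, encoded as pairs: the first component is the colour
of a pillar, and the second one the height of the interval in the order by which the overlap graph
of the intervals at one pillar is a comparability graph. -/
theorem exists_overlap_coloring {k : ℕ} (hkpos : 0 < k)
    (hinj : ∀ u v, u ≠ v → L u ≠ L v ∧ R u ≠ R v ∧ L u ≠ R v) (hLR : ∀ v, L v < R v)
    (hk : ∀ s : Finset V, (∀ u ∈ s, ∀ v ∈ s, u ≠ v → Crosses L R u v ∨ Crosses L R v u) →
      s.card ≤ k) :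
    ∃ c : V → ℕ × ℕ, (∀ v, (c v).1 < 12 * k + 4 ∧ (c v).2 < k) ∧
      ∀ u v, Crosses L R u v → c u ≠ c v := by
  obtain ⟨P, ρ, γ, hhit, h⟩ := exists_pillarAssignment hkpos hinj hLR hk
  obtain ⟨c, hc1, hc2⟩ := exists_height_lt_of_trans (fun u v => ρ u = ρ v ∧ Crosses L R u v)
    (fun u hu => lt_irrefl _ hu.2.1)
    (fun u v w huv hvw => by
      have hu := h.mem u (hhit u)
      have hw := h.mem w (hhit w)
      unfold Crosses at *
      omega) k
    (fun s hs => hk s fun u hu v hv huv => (hs u hu v hv huv).imp And.right And.right)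
  refine ⟨fun v => (γ (ρ v), c v), fun v => ⟨h.color_lt _, hc1 v⟩, fun u v huv heq => ?_⟩
  rw [Prod.mk.injEq] at heq
  exact (hc2 u v ⟨h.proper u v (hhit u) (hhit v) huv heq.1, huv⟩).ne heq.2

end

/-! ### Polygons inscribed in the circle, through the angles of their vertices -/

/-- The point of the unit circle at angle `θ`. -/
noncomputable def circlePoint (θ : ℝ) : EuclideanSpace ℝ (Fin 2) := !₂[Real.cos θ, Real.sin θ]

theorem exists_circlePoint_eq {p : EuclideanSpace ℝ (Fin 2)}
    (hp : p ∈ Metric.sphere (0 : EuclideanSpace ℝ (Fin 2)) 1) :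
    ∃ θ, -Real.pi < θ ∧ θ ≤ Real.pi ∧ circlePoint θ = p := by
  have hp1 : p 0 ^ 2 + p 1 ^ 2 = 1 := by
    have h : ‖p‖ = 1 := by simpa using hp
    have h2 := EuclideanSpace.norm_sq_eq p
    rw [h, Fin.sum_univ_two] at h2
    simpa using h2.symm
  let z : ℂ := ⟨p 0, p 1⟩
  have hz : ‖z‖ = 1 := by
    rw [Complex.norm_eq_sqrt_sq_add_sq, hp1, Real.sqrt_one]
  refine ⟨z.arg, Complex.neg_pi_lt_arg z, Complex.arg_le_pi z, ?_⟩
  have h1 := Complex.norm_mul_cos_arg z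
  have h2 := Complex.norm_mul_sin_arg z
  rw [hz, one_mul] at h1 h2
  ext i
  fin_cases i
  · simpa [circlePoint] using h1
  · simpa [circlePoint] using h2

/-- An inscribed polygon, described by the angles of its vertices in the circle cut open at `π`. -/
theorem IsInscribedPolygon.exists_angles {S : Set (EuclideanSpace ℝ (Fin 2))}
    (hS : IsInscribedPolygon S) :
    ∃ A : Finset ℝ, A.Nonempty ∧ (∀ θ ∈ A, -Real.pi < θ ∧ θ ≤ Real.pi) ∧
      S = convexHull ℝ (circlePoint '' A) := by
  classical
  obtain ⟨B, hB, hBs, rfl⟩ := hS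
  choose! g hg using fun p (hp : p ∈ B) => exists_circlePoint_eq (hBs p hp)
  refine ⟨B.image g, ?_, ?_, ?_⟩
  · rw [Finset.image_nonempty, ← Finset.card_pos]
    omega
  · intro θ hθ
    obtain ⟨p, hp, rfl⟩ := Finset.mem_image.1 hθ
    exact ⟨(hg p hp).1, (hg p hp).2.1⟩
  · congr 1
    rw [Finset.coe_image, Set.image_image]
    ext p
    constructor
    · exact fun hp => ⟨p, hp, (hg p hp).2.2⟩
    · rintro ⟨q, hq, rfl⟩
      simpa [(hg q hq).2.2] using hq

/-- The coordinate of a point of the plane in the direction of angle `μ`. -/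
noncomputable def coordAt (μ : ℝ) (p : EuclideanSpace ℝ (Fin 2)) : ℝ :=
  p 0 * Real.cos μ + p 1 * Real.sin μ

theorem isLinearMap_coordAt (μ : ℝ) : IsLinearMap ℝ (coordAt μ) where
  map_add p q := by simp [coordAt]; ring
  map_smul c p := by simp [coordAt]; ring

theorem coordAt_circlePoint (μ θ : ℝ) : coordAt μ (circlePoint θ) = Real.cos (θ - μ) := by
  simp [coordAt, circlePoint, Real.cos_sub]

/-- Among the angles in `(-π, π]`, those in `[a, b]` are on the far side of the chord from `a` to
`b`, seen in the direction of the midpoint of `[a, b]`. -/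
theorem cos_half_le_of_mem {a b θ : ℝ} (ha : -Real.pi < a) (hb : b ≤ Real.pi)
    (h1 : a ≤ θ) (h2 : θ ≤ b) : Real.cos ((b - a) / 2) ≤ Real.cos (θ - (a + b) / 2) := by
  rw [← Real.cos_abs (θ - (a + b) / 2)]
  apply Real.cos_le_cos_of_nonneg_of_le_pi (abs_nonneg _) (by linarith)
  rw [abs_le]
  constructor <;> linarith

/-- Complement of `cos_half_le_of_mem`, with strict inequality. -/
theorem cos_lt_cos_half_of_notMem {a b θ : ℝ} (ha : -Real.pi < a) (hab : a ≤ b) (hb : b ≤ Real.pi)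
    (h1 : -Real.pi < θ) (h2 : θ ≤ Real.pi) (h : θ < a ∨ b < θ) :
    Real.cos (θ - (a + b) / 2) < Real.cos ((b - a) / 2) := by
  have key : ∀ t, (b - a) / 2 < t → t < 2 * Real.pi - (b - a) / 2 →
      Real.cos t < Real.cos ((b - a) / 2) := by
    intro t ht1 ht2
    rcases le_total t Real.pi with h | h
    · exact Real.cos_lt_cos_of_nonneg_of_le_pi (by linarith) h ht1
    · rw [← Real.cos_two_pi_sub t]
      exact Real.cos_lt_cos_of_nonneg_of_le_pi (by linarith) (by linarith) (by linarith)
  rcases h with h | h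
  · rw [← Real.cos_neg]
    exact key _ (by linarith) (by linarith)
  · exact key _ (by linarith) (by linarith)

/-- The line through the points at angles `a` and `b` separates the polygons with vertices inside
and outside `[a, b]`. -/
theorem disjoint_convexHull_circlePoint {A B : Set ℝ} {a b : ℝ} (ha : -Real.pi < a) (hab : a ≤ b)
    (hb : b ≤ Real.pi) (hA : ∀ θ ∈ A, a ≤ θ ∧ θ ≤ b)
    (hB : ∀ θ ∈ B, -Real.pi < θ ∧ θ ≤ Real.pi ∧ (θ < a ∨ b < θ)) :
    ¬ (convexHull ℝ (circlePoint '' A) ∩ convexHull ℝ (circlePoint '' B)).Nonempty := by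
  rintro ⟨p, hpA, hpB⟩
  have h1 : convexHull ℝ (circlePoint '' A) ⊆
      {p | Real.cos ((b - a) / 2) ≤ coordAt ((a + b) / 2) p} := by
    apply convexHull_min _ (convex_halfSpace_ge (isLinearMap_coordAt _) _)
    rintro _ ⟨θ, hθ, rfl⟩
    rw [Set.mem_ofPred_eq, coordAt_circlePoint]
    exact cos_half_le_of_mem ha hb (hA θ hθ).1 (hA θ hθ).2
  have h2 : convexHull ℝ (circlePoint '' B) ⊆
      {p | coordAt ((a + b) / 2) p < Real.cos ((b - a) / 2)} := by
    apply convexHull_min _ (convex_halfSpace_lt (isLinearMap_coordAt _) _)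
    rintro _ ⟨θ, hθ, rfl⟩
    rw [Set.mem_ofPred_eq, coordAt_circlePoint]
    obtain ⟨h3, h4, h5⟩ := hB θ hθ
    exact cos_lt_cos_half_of_notMem ha hab hb h3 h4 h5
  have h3 := h1 hpA
  have h4 := h2 hpB
  rw [Set.mem_ofPred_eq] at h3 h4
  linarith

/-- A point of the closed disc on the line through the points at angles `x` and `y` lies on the
chord between them. -/
theorem mem_segment_circlePoint {x y : ℝ} (hxy : x ≤ y) (hpi : y - x ≤ 2 * Real.pi)
    {q : EuclideanSpace ℝ (Fin 2)} (hq : q 0 ^ 2 + q 1 ^ 2 ≤ 1)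
    (hline : coordAt ((x + y) / 2) q = Real.cos ((y - x) / 2)) :
    q ∈ segment ℝ (circlePoint x) (circlePoint y) := by
  obtain ⟨μ, hμ⟩ : ∃ μ, μ = (x + y) / 2 := ⟨_, rfl⟩
  obtain ⟨h, hh⟩ : ∃ h, h = (y - x) / 2 := ⟨_, rfl⟩
  obtain rfl : x = μ - h := by rw [hμ, hh]; ring
  obtain rfl : y = μ + h := by linarith
  rw [← hμ, ← hh] at hline
  have hsin : 0 ≤ Real.sin h := Real.sin_nonneg_of_nonneg_of_le_pi (by linarith) (by linarith)
  -- The coordinate along the chord.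
  obtain ⟨w, hw⟩ : ∃ w, w = q 1 * Real.cos μ - q 0 * Real.sin μ := ⟨_, rfl⟩
  rw [coordAt] at hline
  have hμ1 := Real.sin_sq_add_cos_sq μ
  have hh1 := Real.sin_sq_add_cos_sq h
  have hw2 : w ^ 2 ≤ Real.sin h ^ 2 := by
    have : w ^ 2 + Real.cos h ^ 2 = q 0 ^ 2 + q 1 ^ 2 := by
      rw [hw, ← hline]
      linear_combination (q 0 ^ 2 + q 1 ^ 2) * hμ1
    linarith
  have hwabs := abs_le_of_sq_le_sq' hw2 hsin
  have hq0 : q 0 = Real.cos h * Real.cos μ - w * Real.sin μ := by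
    rw [hw, ← hline]
    linear_combination -(q 0) * hμ1
  have hq1 : q 1 = Real.cos h * Real.sin μ + w * Real.cos μ := by
    rw [hw, ← hline]
    linear_combination -(q 1) * hμ1
  obtain ⟨t, ht0, ht1, ht⟩ : ∃ t : ℝ, 0 ≤ t ∧ t ≤ 1 ∧ w = (2 * t - 1) * Real.sin h := by
    rcases hsin.eq_or_lt with h0 | hpos
    · refine ⟨0, le_rfl, zero_le_one, ?_⟩
      rw [← h0] at hwabs ⊢
      linarith
    · refine ⟨(w + Real.sin h) / (2 * Real.sin h), div_nonneg (by linarith) (by linarith), ?_, ?_⟩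
      · rw [div_le_one (by linarith)]
        linarith
      · field_simp
        ring
  refine ⟨1 - t, t, by linarith, ht0, by ring, ?_⟩
  ext i
  fin_cases i
  · simp [circlePoint, Real.cos_add, Real.cos_sub, hq0, ht]
    ring
  · simp [circlePoint, Real.sin_add, Real.sin_sub, hq1, ht]
    ring

/-- Polygons with interleaving vertices intersect: `z` is on the arc from `x` to `y`, and `w` is on
the complementary arc. -/
theorem convexHull_circlePoint_inter_nonempty {A B : Set ℝ} {x y z w : ℝ} (hx : x ∈ A) (hy : y ∈ A)
    (hz : z ∈ B) (hw : w ∈ B) (hx1 : -Real.pi < x) (hy1 : y ≤ Real.pi)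
    (hw1 : -Real.pi < w) (hw2 : w ≤ Real.pi) (hxz : x ≤ z) (hzy : z ≤ y) (h : w ≤ x ∨ y ≤ w) :
    (convexHull ℝ (circlePoint '' A) ∩ convexHull ℝ (circlePoint '' B)).Nonempty := by
  have hxy : x ≤ y := hxz.trans hzy
  obtain ⟨c, hc⟩ : ∃ c, c = Real.cos ((y - x) / 2) := ⟨_, rfl⟩
  have hz' : c ≤ coordAt ((x + y) / 2) (circlePoint z) := by
    rw [coordAt_circlePoint, hc]
    exact cos_half_le_of_mem hx1 hy1 hxz hzy
  have hw' : coordAt ((x + y) / 2) (circlePoint w) ≤ c := by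
    rw [coordAt_circlePoint, hc]
    rcases h with h | h
    · rcases h.eq_or_lt with rfl | h
      · rw [← Real.cos_neg]
        apply le_of_eq
        congr 1
        ring
      · exact (cos_lt_cos_half_of_notMem hx1 hxy hy1 hw1 hw2 (Or.inl h)).le
    · rcases h.eq_or_lt with rfl | h
      · apply le_of_eq
        congr 1
        ring
      · exact (cos_lt_cos_half_of_notMem hx1 hxy hy1 hw1 hw2 (Or.inr h)).le
  obtain ⟨t, ht0, ht1, ht⟩ : ∃ t : ℝ, 0 ≤ t ∧ t ≤ 1 ∧
      (1 - t) * coordAt ((x + y) / 2) (circlePoint z) +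
        t * coordAt ((x + y) / 2) (circlePoint w) = c := by
    rcases (hw'.trans hz').eq_or_lt with h0 | hpos
    · refine ⟨0, le_rfl, zero_le_one, ?_⟩
      linarith
    · refine ⟨(coordAt ((x + y) / 2) (circlePoint z) - c) /
        (coordAt ((x + y) / 2) (circlePoint z) - coordAt ((x + y) / 2) (circlePoint w)),
        div_nonneg (by linarith) (by linarith), ?_, ?_⟩
      · rw [div_le_one (by linarith)]
        linarith
      · have : coordAt ((x + y) / 2) (circlePoint z) -
            coordAt ((x + y) / 2) (circlePoint w) ≠ 0 := by linarith
        field_simp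
        ring
  have hq : (1 - t) • circlePoint z + t • circlePoint w ∈
      segment ℝ (circlePoint z) (circlePoint w) := ⟨1 - t, t, by linarith, ht0, by ring, rfl⟩
  refine ⟨(1 - t) • circlePoint z + t • circlePoint w, ?_, ?_⟩
  · apply segment_subset_convexHull (Set.mem_image_of_mem _ hx) (Set.mem_image_of_mem _ hy)
    apply mem_segment_circlePoint hxy (by linarith)
    · have h1 := Real.sin_sq_add_cos_sq z
      have h2 := Real.sin_sq_add_cos_sq w
      have h3 := Real.cos_le_one (z - w)
      rw [Real.cos_sub] at h3
      have h4 : 0 ≤ 2 * (t * (1 - t)) := by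
        have := mul_nonneg ht0 (sub_nonneg.2 ht1)
        linarith
      have h5 := mul_le_mul_of_nonneg_left h3 h4
      simp [circlePoint]
      linear_combination h5 + (1 - t) ^ 2 * h1 + t ^ 2 * h2
    · rw [← hc, ← ht, (isLinearMap_coordAt _).map_add, (isLinearMap_coordAt _).map_smul,
        (isLinearMap_coordAt _).map_smul, smul_eq_mul, smul_eq_mul]
  · exact segment_subset_convexHull (Set.mem_image_of_mem _ hz) (Set.mem_image_of_mem _ hw) hq

/-! ### From polygons to intervals -/

/-- The ends of finitely many real intervals can be moved to distinct naturals so that touching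
intervals become overlapping and nothing else changes: equal left ends are ordered by right ends and
conversely, and a left end precedes an equal right end. -/
theorem exists_distinct_ends {V : Type*} [Fintype V] (a b : V → ℝ) (hab : ∀ v, a v ≤ b v) :
    ∃ L R : V → ℕ, (∀ u v, u ≠ v → L u ≠ L v ∧ R u ≠ R v ∧ L u ≠ R v) ∧ (∀ v, L v < R v) ∧
      (∀ u v, Crosses L R u v → a u ≤ a v ∧ a v ≤ b u ∧ b u ≤ b v) ∧
      ∀ u v, L u < L v → ¬ Crosses L R u v → b u < a v ∨ (a u < a v ∧ b v < b u) := by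
  classical
  let idx : V → ℕ := fun v => Fintype.equivFin V v
  have hidx : ∀ u v, idx u = idx v → u = v := fun u v h =>
    (Fintype.equivFin V).injective (Fin.ext h)
  let key : V ⊕ V → ℝ ×ₗ (ℕ ×ₗ (ℝ ×ₗ ℕ)) := Sum.elim
    (fun v => toLex (a v, toLex (0, toLex (b v, idx v))))
    (fun v => toLex (b v, toLex (1, toLex (a v, idx v))))
  let pos : V ⊕ V → ℕ := fun x => (Finset.univ.filter fun y => key y < key x).card
  have hpos : ∀ x y, key x < key y → pos x < pos y := by
    intro x y hxy
    apply Finset.card_lt_card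
    rw [Finset.ssubset_iff_of_subset]
    · exact ⟨x, by simp [hxy], by simp⟩
    · intro z hz
      simp only [Finset.mem_filter, Finset.mem_univ, true_and] at hz ⊢
      exact hz.trans hxy
  have hpos' : ∀ x y, pos x < pos y ↔ key x < key y := by
    refine fun x y => ⟨fun h => ?_, hpos x y⟩
    by_contra hcon
    rcases (not_lt.1 hcon).eq_or_lt with h1 | h1
    · simp only [pos, h1] at h
      exact lt_irrefl _ h
    · exact lt_asymm h (hpos _ _ h1)
  have hposne : ∀ x y, key x ≠ key y → pos x ≠ pos y := by
    intro x y hxy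
    rcases lt_or_gt_of_ne hxy with h | h
    · exact (hpos _ _ h).ne
    · exact (hpos _ _ h).ne'
  have hLL : ∀ u v, pos (Sum.inl u) < pos (Sum.inl v) ↔
      a u < a v ∨ a u = a v ∧ (b u < b v ∨ b u = b v ∧ idx u < idx v) := by
    intro u v
    rw [hpos']
    simp [key, Prod.Lex.toLex_lt_toLex]
  have hRR : ∀ u v, pos (Sum.inr u) < pos (Sum.inr v) ↔
      b u < b v ∨ b u = b v ∧ (a u < a v ∨ a u = a v ∧ idx u < idx v) := by
    intro u v
    rw [hpos']
    simp [key, Prod.Lex.toLex_lt_toLex]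
  have hLR : ∀ u v, pos (Sum.inl u) < pos (Sum.inr v) ↔ a u ≤ b v := by
    intro u v
    rw [hpos']
    simp [key, Prod.Lex.toLex_lt_toLex, le_iff_lt_or_eq]
  refine ⟨fun v => pos (Sum.inl v), fun v => pos (Sum.inr v), ?_, ?_, ?_, ?_⟩
  · intro u v huv
    have hi : idx u ≠ idx v := fun h => huv (hidx u v h)
    refine ⟨hposne _ _ ?_, hposne _ _ ?_, hposne _ _ ?_⟩ <;> simp [key, hi]
  · exact fun v => (hLR v v).2 (hab v)
  · rintro u v ⟨h1, h2, h3⟩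
    rw [hLL] at h1
    rw [hLR] at h2
    rw [hRR] at h3
    refine ⟨?_, h2, ?_⟩ <;> grind
  · intro u v h1 h2
    by_cases h3 : a v ≤ b u
    · have h4 : ¬ pos (Sum.inr u) < pos (Sum.inr v) := fun h4 => h2 ⟨h1, (hLR v u).2 h3, h4⟩
      rw [hRR] at h4
      rw [hLL] at h1
      right
      grind
    · exact Or.inl (not_le.1 h3)

/-- Polygon circle graphs in terms of the angles of the vertices: the overlap graph of the intervals
spanned by the polygons is coloured as a circle graph, and each of its colour classes, where the
intervals form a laminar family, is then coloured greedily from the outside inwards. -/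
theorem colorable_of_angles {V : Type*} [Fintype V] (G : SimpleGraph V) (A : V → Finset ℝ)
    (hne : ∀ v, (A v).Nonempty) (hpi : ∀ v, ∀ θ ∈ A v, -Real.pi < θ ∧ θ ≤ Real.pi)
    (hG : G = intersectionGraph fun v => convexHull ℝ (circlePoint '' (A v : Set ℝ)))
    {k : ℕ} (hkpos : 0 < k) (hk : ∀ s : Finset V, G.IsClique s → s.card ≤ k) :
    G.Colorable ((12 * k + 4) * k * k) := by
  classical
  let a : V → ℝ := fun v => (A v).min' (hne v)
  let b : V → ℝ := fun v => (A v).max' (hne v)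
  have ha : ∀ v, a v ∈ A v := fun v => Finset.min'_mem _ _
  have hb : ∀ v, b v ∈ A v := fun v => Finset.max'_mem _ _
  have haA : ∀ v, ∀ θ ∈ A v, a v ≤ θ := fun v θ hθ => Finset.min'_le _ _ hθ
  have hAb : ∀ v, ∀ θ ∈ A v, θ ≤ b v := fun v θ hθ => Finset.le_max' _ _ hθ
  have hab : ∀ v, a v ≤ b v := fun v => haA v _ (hb v)
  obtain ⟨L, R, hinj, hLR, hcr, hncr⟩ := exists_distinct_ends a b hab
  have hadj : ∀ u v, G.Adj u v ↔ u ≠ v ∧ (convexHull ℝ (circlePoint '' (A u : Set ℝ)) ∩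
      convexHull ℝ (circlePoint '' (A v : Set ℝ))).Nonempty := by
    intro u v
    rw [hG]
    rfl
  -- A vertex of the outer polygon facing the inner one makes them intersect.
  have hmeet : ∀ u v, u ≠ v → a u ≤ a v → (∃ t ∈ A u, a v ≤ t ∧ t ≤ b v) → G.Adj u v := by
    rintro u v huv hauv ⟨t, ht, h1, h2⟩
    rw [hadj, Set.inter_comm]
    exact ⟨huv, convexHull_circlePoint_inter_nonempty (ha v) (hb v) ht (ha u) (hpi v _ (ha v)).1
      (hpi v _ (hb v)).2 (hpi u _ (ha u)).1 (hpi u _ (ha u)).2 h1 h2 (Or.inl hauv)⟩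
  have hcross : ∀ u v, Crosses L R u v → G.Adj u v := by
    intro u v h
    obtain ⟨h1, h2, h3⟩ := hcr u v h
    exact hmeet u v (fun huv => absurd h.1 (by rw [huv]; exact lt_irrefl _)) h1 ⟨b u, hb u, h2, h3⟩
  obtain ⟨c, hc, hcproper⟩ := exists_overlap_coloring hkpos hinj hLR fun s hs =>
    hk s fun u hu v hv huv => (hs u hu v hv huv).elim (hcross u v) fun h => (hcross v u h).symm
  -- Within a colour class, adjacent polygons are nested, with a vertex of the outer one facing the
  -- inner one.
  have hnest : ∀ u v, G.Adj u v → c u = c v → L u < L v →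
      a u < a v ∧ b v < b u ∧ ∃ t ∈ A u, a v ≤ t ∧ t ≤ b v := by
    intro u v huv hcuv hL
    rw [hadj, Set.inter_comm] at huv
    have hfar : ∃ t ∈ A u, a v ≤ t ∧ t ≤ b v := by
      by_contra hcon
      push Not at hcon
      refine disjoint_convexHull_circlePoint (hpi v _ (ha v)).1 (hab v) (hpi v _ (hb v)).2
        (fun θ hθ => ⟨haA v θ hθ, hAb v θ hθ⟩) (fun θ hθ => ⟨(hpi u θ hθ).1, (hpi u θ hθ).2, ?_⟩)
        huv.2
      exact (lt_or_ge θ (a v)).imp_right (hcon θ hθ)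
    rcases hncr u v hL (fun h => hcproper u v h hcuv) with h | h
    · obtain ⟨t, ht, h1, _⟩ := hfar
      exact absurd (h.trans_le (h1.trans (hAb u t ht))) (lt_irrefl _)
    · exact ⟨h.1, h.2, hfar⟩
  obtain ⟨d, hd, hdproper⟩ := exists_greedy_coloring (fun u v => G.Adj u v ∧ c u = c v)
    (fun u v h => ⟨h.1.symm, h.2.symm⟩) L (fun u v h => (hinj u v h.1.ne).1) k (by
      intro v s hs
      have hclique : ∀ u ∈ s, ∀ w ∈ s, L u < L w → G.Adj u w := by
        intro u hu w hw huw
        obtain ⟨⟨hu1, hu2⟩, hu3⟩ := hs u hu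
        obtain ⟨⟨hw1, hw2⟩, hw3⟩ := hs w hw
        obtain ⟨hu4, hu5, t, ht, hvt, htv⟩ := hnest u v hu1 hu2 hu3
        obtain ⟨hw4, hw5, _⟩ := hnest w v hw1 hw2 hw3
        have hne : u ≠ w := fun h => absurd huw (by rw [h]; exact lt_irrefl _)
        have habv := hab v
        rcases hncr u w huw (fun h => hcproper u w h (hu2.trans hw2.symm)) with h | h
        · linarith
        · exact hmeet u w hne h.1.le ⟨t, ht, by linarith, by linarith⟩
      have hv : v ∉ s := fun h => lt_irrefl _ (hs v h).2
      have := hk (insert v s) (by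
        rw [Finset.coe_insert]
        refine SimpleGraph.IsClique.insert (fun u hu w hw huw => ?_) fun u hu _ => (hs u hu).1.1.symm
        rcases lt_or_gt_of_ne (hinj u w huw).1 with h | h
        · exact hclique u hu w hw h
        · exact (hclique w hw u hu h).symm)
      rw [Finset.card_insert_of_notMem hv] at this
      omega)
  have hcol := (SimpleGraph.Coloring.mk
    (fun v => (((⟨(c v).1, (hc v).1⟩ : Fin (12 * k + 4)), (⟨(c v).2, (hc v).2⟩ : Fin k)),
      (⟨d v, hd v⟩ : Fin k))) (by
      intro u v huv heq
      simp only [Prod.mk.injEq, Fin.mk.injEq] at heq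
      exact hdproper u v ⟨huv, Prod.ext heq.1.1 heq.1.2⟩ heq.2) : G.Coloring _).colorable
  simpa using hcol

theorem mainTheorem4 {V : Type*} (G : SimpleGraph V) (hG : IsPolygonCircleGraph G) :
    G.chromaticNumber ≤ ((7 * G.cliqueNum ^ 4 : ℕ) : ℕ∞) := by
  obtain ⟨hV, F, hF, hGF⟩ := hG
  have := Fintype.ofFinite V
  choose A hne hpi hFA using fun v => (hF v).exists_angles
  have hk : ∀ s : Finset V, G.IsClique s → s.card ≤ G.cliqueNum := fun s hs => hs.card_le_cliqueNum
  apply SimpleGraph.Colorable.chromaticNumber_le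
  rcases isEmpty_or_nonempty V with hV | ⟨⟨v₀⟩⟩
  · exact SimpleGraph.Colorable.of_isEmpty _
  have h1 : 1 ≤ G.cliqueNum := by simpa using hk {v₀} (by simp)
  rcases h1.eq_or_lt with h1 | h2
  · -- With clique number one there are no edges, and a single colour suffices.
    refine SimpleGraph.Colorable.mono (n := 1) (by rw [← h1]; norm_num)
      ⟨SimpleGraph.Coloring.mk (fun _ => 0) fun {u v} huv => ?_⟩
    classical
    have := hk {u, v} (by simpa [SimpleGraph.isClique_pair] using fun _ => huv)
    rw [Finset.card_pair huv.ne] at this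
    omega
  · refine (colorable_of_angles G A hne hpi ?_ h1 hk).mono ?_
    · rw [hGF]
      congr 1
      exact funext hFA
    · generalize G.cliqueNum = k at h2
      have h3 : 12 * k + 4 ≤ 7 * k ^ 2 := by nlinarith
      calc (12 * k + 4) * k * k = (12 * k + 4) * k ^ 2 := by ring
        _ ≤ 7 * k ^ 2 * k ^ 2 := Nat.mul_le_mul_right _ h3
        _ = 7 * k ^ 4 := by ring
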